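/- Let $(X,Y)$ be a pair of correlated finite-alphabet memoryless sources with joint distribution $P_{XY}$ on $\mathcal X\times\mathcal Y$, let $d^{(1)}:\mathcal X\times\hat{\mathcal X}\to[0,\infty)$ and $d^{(2)}:\mathcal Y\times\hat{\mathcal Y}\to[0,\infty)$ be distortion functions with finite reconstruction alphabets, and let $d_n^{(i)}$ be the induced per-letter averages on $n$-sequences. All logarithms are to base $2$. A lossy complementary delivery code of block length $n$ consists of an encoder $f_n:\mathcal X^n\times\mathcal Y^n\to\{1,\dots,M_n\}$ and decoders $\phi_n^{(1)}:\{1,\dots,M_n\}\times\mathcal Y^n\to\hat{\mathcal X}^n$, $\phi_n^{(2)}:\{1,\dots,M_n\}\times\mathcal X^n\to\hat{\mathcal Y}^n$. A rate $R$ is $(\Delta^{(1)},\Delta^{(2)})$-achievable if there is a sequence of such codes with $\limsup_n \frac1n\log M_n\le R$, $\limsup_n E[d_n^{(1)}(X^n,\phi_n^{(1)}(f_n(X^n,Y^n),Y^n))]\le\Delta^{(1)}$ and $\limsup_n E[d_n^{(2)}(Y^n,\phi_n^{(2)}(f_n(X^n,Y^n),X^n))]\le\Delta^{(2)}$. Let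 $R^*(X,Y|\Delta^{(1)},\Delta^{(2)})$ be the infimum of the achievable rates. The Wyner–Ziv rate $R_{WZ}^{(1)}(\Delta^{(1)},P_{XY})$ of the source $X$ with side information $Y$ is the minimum of $I(X;U)-I(Y;U)$ over all random variables $U$ with values in an alphabet $\mathcal U$, $|\mathcal U|\le|\mathcal X|+1$, such that $P_{XYU}(x,y,u)=P_{XY}(x,y)P_{U|X}(u|x)$ and $E[d^{(1)}(X,\varphi(U,Y))]\le\Delta^{(1)}$ for some function $\varphi:\mathcal U\times\mathcal Y\to\hat{\mathcal X}$; $R_{WZ}^{(2)}(\Delta^{(2)},P_{XY})$ is defined in the same way with the roles of $X$ and $Y$ exchanged and with $d^{(2)}$. Theorem. There exist a pair $(X,Y)$ of sources, distortion functions and distortion levels $\Delta^{(1)},\Delta^{(2)}$ (for which these rates are infima over non-empty sets), with all alphabets equal to $\{0,1\}$, such that $$\max_{i=1,2}R_{WZ}^{(i)}(\Delta^{(i)},P_{XY})>R^*(X,Y|\Delta^{(1)},\Delta^{(2)}).$$ More precisely, let $0<p<1/2$, let $(X,Y)$ be the doubly symmetric binary source, $P_{XY}(x,y)=(1-p)/2$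 if $x=y$ and $p/2$ if $x\ne y$ ($x,y\in\{0,1\}$), let $d^{(1)}=d^{(2)}$ be the Hamming distortion on $\{0,1\}$, and let $h(t)=-t\log t-(1-t)\log(1-t)$. Then for $0\le\Delta<p$, $$R^*(X,Y|\Delta,\Delta)=h(p)-h(\Delta),$$ and for $0<\Delta<p$, $$h(p)-h(\Delta)<R_{WZ}^{(i)}(\Delta,P_{XY})\qquad(i=1,2).$$ -/

import Mathlib

namespace ComplementaryDelivery

noncomputable section

/-- Entropy, in bits, of a probability mass function on a finite alphabet. -/
def entropy {α : Type*} [Fintype α] (q : α → ℝ) : ℝ :=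
  -∑ a, q a * Real.logb 2 (q a)

/-- Mutual information, in bits, `I(A;B) = H(A) + H(B) - H(A,B)`, of a pair of random variables
with joint probability mass function `q`. -/
def mutualInfo {α β : Type*} [Fintype α] [Fintype β] (q : α × β → ℝ) : ℝ :=
  entropy (fun a => ∑ b, q (a, b)) + entropy (fun b => ∑ a, q (a, b)) - entropy q

/-- The binary entropy function, in bits. -/
def h (t : ℝ) : ℝ :=
  -t * Real.logb 2 t - (1 - t) * Real.logb 2 (1 - t)

/-! ### Lossy complementary delivery -/

/-- The normalized distortion between two sequences of length `n`. -/
def seqDist {α β : Type*} (d : α → β → ℝ) {n : ℕ} (x : Fin n → α) (z : Fin n → β) : ℝ :=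
  (∑ i, d (x i) (z i)) / n

/-- A lossy complementary delivery code of block length `n`: an encoder that sees both sequences,
a first decoder that reproduces the `𝒳`-sequence with the `𝒴`-sequence as side information, and a
second decoder that does the converse. There are `size` messages. -/
structure Code (𝒳 𝒴 𝒳' 𝒴' : Type*) (n : ℕ) where
  size : ℕ
  enc : (Fin n → 𝒳) → (Fin n → 𝒴) → Fin size
  dec₁ : Fin size → (Fin n → 𝒴) → (Fin n → 𝒳')
  dec₂ : Fin size → (Fin n → 𝒳) → (Fin n → 𝒴')

variable {𝒳 𝒴 𝒳' 𝒴' : Type*} [Fintype 𝒳] [Fintype 𝒴]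

/-- Expectation of `F (Xⁿ, Yⁿ)` for `n` i.i.d. copies of the pair `(X, Y)` with joint probability
mass function `P`. -/
def expect (P : 𝒳 × 𝒴 → ℝ) (n : ℕ) (F : (Fin n → 𝒳) → (Fin n → 𝒴) → ℝ) : ℝ :=
  ∑ x : Fin n → 𝒳, ∑ y : Fin n → 𝒴, (∏ i, P (x i, y i)) * F x y

/-- `R` is `(Δ₁, Δ₂)`-achievable. The upper limits are taken in the extended reals, so that an
unbounded sequence has upper limit `+∞`. -/
def IsAchievable (P : 𝒳 × 𝒴 → ℝ) (d₁ : 𝒳 → 𝒳' → ℝ) (d₂ : 𝒴 → 𝒴' → ℝ) (Δ₁ Δ₂ R : ℝ) : Prop :=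
  ∃ c : (n : ℕ) → Code 𝒳 𝒴 𝒳' 𝒴' n,
    Filter.limsup (fun n : ℕ => ((Real.logb 2 ((c n).size : ℝ) / n : ℝ) : EReal)) Filter.atTop
      ≤ (R : EReal) ∧
    Filter.limsup (fun n : ℕ =>
      ((expect P n fun x y => seqDist d₁ x ((c n).dec₁ ((c n).enc x y) y) : ℝ) : EReal))
      Filter.atTop ≤ (Δ₁ : EReal) ∧
    Filter.limsup (fun n : ℕ =>
      ((expect P n fun x y => seqDist d₂ y ((c n).dec₂ ((c n).enc x y) x) : ℝ) : EReal))
      Filter.atTop ≤ (Δ₂ : EReal)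

/-- The set of achievable rates. -/
def achievableRates (P : 𝒳 × 𝒴 → ℝ) (d₁ : 𝒳 → 𝒳' → ℝ) (d₂ : 𝒴 → 𝒴' → ℝ) (Δ₁ Δ₂ : ℝ) : Set ℝ :=
  {R | IsAchievable P d₁ d₂ Δ₁ Δ₂ R}

/-- The optimal rate `R*(X,Y|Δ₁,Δ₂)` of lossy complementary delivery. -/
def optimalRate (P : 𝒳 × 𝒴 → ℝ) (d₁ : 𝒳 → 𝒳' → ℝ) (d₂ : 𝒴 → 𝒴' → ℝ) (Δ₁ Δ₂ : ℝ) : ℝ :=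
  sInf (achievableRates P d₁ d₂ Δ₁ Δ₂)

/-! ### The Wyner–Ziv rate -/

/-- The values `I(X;U) - I(Y;U)` over all auxiliary variables `U` that are admissible in the
Wyner–Ziv problem for the source `X` with side information `Y` at the decoder: `U` takes values in
an alphabet of size `k ≤ |𝒳| + 1`, its conditional law given `(X, Y) = (x, y)` is `W x`, and some
`φ` reproduces `X` from `(U, Y)` within expected distortion `Δ`. -/
def wzRates (P : 𝒳 × 𝒴 → ℝ) (d : 𝒳 → 𝒳' → ℝ) (Δ : ℝ) : Set ℝ :=
  {r | ∃ k : ℕ, k ≤ Fintype.card 𝒳 + 1 ∧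
    ∃ W : 𝒳 → Fin k → ℝ, (∀ x, W x ∈ stdSimplex ℝ (Fin k)) ∧
    (∃ φ : Fin k → 𝒴 → 𝒳', ∑ x, ∑ y, ∑ u, P (x, y) * W x u * d x (φ u y) ≤ Δ) ∧
    r = mutualInfo (fun xu : 𝒳 × Fin k => ∑ y, P (xu.1, y) * W xu.1 xu.2) -
        mutualInfo (fun yu : 𝒴 × Fin k => ∑ x, P (x, yu.1) * W x yu.2)}

/-- The Wyner–Ziv rate of the source `X` with side information `Y`. -/
def wzRate (P : 𝒳 × 𝒴 → ℝ) (d : 𝒳 → 𝒳' → ℝ) (Δ : ℝ) : ℝ :=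
  sInf (wzRates P d Δ)

/-- The joint probability mass function of `(Y, X)`, given that of `(X, Y)`. The Wyner–Ziv rate of
the source `Y` with side information `X` is the one of the swapped pair. -/
def swapped (P : 𝒳 × 𝒴 → ℝ) : 𝒴 × 𝒳 → ℝ := fun yx => P (yx.2, yx.1)

/-! ### The doubly symmetric binary source -/

/-- The doubly symmetric binary source with crossover probability `p`. -/
def dsbs (p : ℝ) : Fin 2 × Fin 2 → ℝ :=
  fun xy => if xy.1 = xy.2 then (1 - p) / 2 else p / 2

/-- Hamming distortion on `{0, 1}`. -/
def hamming (a b : Fin 2) : ℝ := if a = b then 0 else 1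

end

end ComplementaryDelivery

namespace ComplementaryDelivery

/-! ### The binary entropy function -/

/-! The encoder sees both sequences, so it can quantize `z = x + y` and send the index of the
codeword. Each decoder adds its own side information, and the error in `z` becomes exactly its own
error. Since `z` is Bernoulli(`p`) and independent of `y`, one rate-distortion code for `z`, of rate
`h p - h Δ`, serves both decoders. `exists_covering` finds it by random coding,
`exists_hamming_covering` specializes it to Hamming distance, and `exists_code` turns it into a
delivery code.

Conversely, the first decoder alone forces this rate. For fixed `y` the message and the error
pattern determine `z`, so Gibbs' inequality against uniform message times Bernoulli noise bounds the
number of messages (`le_logb_size`).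

A Wyner–Ziv encoder does not see `y`. If `P(X = 1 | U = u) = t`, the letter `u` costs `h (bconv p t)
- h t`, and the least error probability given `U = u` is `min (min t (1 - t)) p`. By `wz_gap_pos`
these pairs lie strictly above the tangent at `Δ` to the curve `h p - h`; compactness makes the gap
uniform, and averaging over `u` keeps every Wyner–Ziv rate away from `h p - h Δ`
(`exists_lt_wzRates`). -/

lemma h_eq_binEntropy (t : ℝ) : h t = Real.binEntropy t / Real.log 2 := by
  simp only [h, Real.binEntropy, Real.logb, Real.log_inv]
  ring

lemma continuous_h : Continuous h := by
  have : h = fun t => Real.binEntropy t / Real.log 2 := funext h_eq_binEntropy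
  rw [this]
  fun_prop

lemma h_one_sub (t : ℝ) : h (1 - t) = h t := by
  simp [h_eq_binEntropy]

lemma h_lt_h {s t : ℝ} (hs : 0 ≤ s) (hst : s < t) (ht : t ≤ 1 / 2) : h s < h t := by
  rw [h_eq_binEntropy, h_eq_binEntropy]
  refine div_lt_div_of_pos_right ?_ (Real.log_pos one_lt_two)
  exact Real.binEntropy_strictMonoOn ⟨hs, by linarith⟩ ⟨by linarith, by linarith⟩ hst

lemma h_le_h {s t : ℝ} (hs : 0 ≤ s) (hst : s ≤ t) (ht : t ≤ 1 / 2) : h s ≤ h t := by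
  rcases hst.eq_or_lt with rfl | hst
  · rfl
  · exact (h_lt_h hs hst ht).le

/-- The slope of the binary entropy function at `s`. -/
noncomputable def hSlope (s : ℝ) : ℝ := Real.logb 2 (1 - s) - Real.logb 2 s

lemma hSlope_pos {s : ℝ} (hs : 0 < s) (hs' : s < 1 / 2) : 0 < hSlope s :=
  sub_pos.2 (Real.logb_lt_logb one_lt_two hs (by linarith))

/-- This is `log v < v - 1` at `v = s / t`. The correction `s - t` cancels against that of the pair
`1 - s`, `1 - t`, which yields the tangent inequality for `h`. -/
lemma negMulLog_lt {s t : ℝ} (hs : 0 < s) (ht : 0 ≤ t) (hst : t ≠ s) :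
    -t * Real.log t < -t * Real.log s + (s - t) := by
  rcases ht.eq_or_lt with rfl | ht
  · simpa using hs
  · have h1 := Real.log_lt_sub_one_of_pos (div_pos hs ht) (by
      rw [ne_eq, div_eq_one_iff_eq ht.ne']; exact hst.symm)
    rw [Real.log_div hs.ne' ht.ne'] at h1
    have h2 := mul_lt_mul_of_pos_left h1 ht
    have h3 : t * (s / t - 1) = s - t := by field_simp
    rw [h3] at h2
    linarith

/-- The binary entropy function lies strictly below its tangents. -/
lemma h_lt_tangent {s t : ℝ} (hs : 0 < s) (hs' : s < 1) (ht : 0 ≤ t) (ht' : t ≤ 1) (hst : t ≠ s) :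
    h t < h s + hSlope s * (t - s) := by
  have h1 := negMulLog_lt hs ht hst
  have h2 := negMulLog_lt (s := 1 - s) (t := 1 - t) (by linarith) (by linarith)
    (fun he => hst (by linarith))
  have hl : 0 < Real.log 2 := Real.log_pos one_lt_two
  have key : (-t * Real.log t - (1 - t) * Real.log (1 - t)) / Real.log 2 <
      (-t * Real.log s - (1 - t) * Real.log (1 - s)) / Real.log 2 := by
    gcongr ?_ / _
    linarith
  calc h t = (-t * Real.log t - (1 - t) * Real.log (1 - t)) / Real.log 2 := by
        simp only [h, Real.logb]; ring
    _ < _ := key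
    _ = _ := by simp only [h, hSlope, Real.logb]; ring

/-! ### Sums over product distributions -/

section Product

variable {α : Type*} [Fintype α] {n : ℕ}

lemma sum_fin_succ_fun (F : (Fin (n + 1) → α) → ℝ) :
    ∑ w, F w = ∑ a, ∑ w : Fin n → α, F (Fin.cons a w) := by
  rw [← (Fin.consEquiv fun _ => α).sum_comp, Fintype.sum_prod_type]
  rfl

lemma sum_prod_eq_one {J : α → ℝ} (hJ : ∑ a, J a = 1) : ∑ w : Fin n → α, ∏ i, J (w i) = 1 := by
  rw [← Fintype.sum_pow, hJ, one_pow]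

/-- The first moment of a sum of independent copies. -/
lemma sum_prod_mul_sum {J : α → ℝ} (hJ : ∑ a, J a = 1) (f : α → ℝ) :
    ∑ w : Fin n → α, (∏ i, J (w i)) * ∑ i, f (w i) = n * ∑ a, J a * f a := by
  induction n with
  | zero => simp
  | succ n ih =>
    rw [sum_fin_succ_fun]
    have : ∀ a, ∑ w : Fin n → α, (∏ i, J ((Fin.cons a w : Fin (n + 1) → α) i)) *
        ∑ i, f ((Fin.cons a w : Fin (n + 1) → α) i) =
        J a * f a + J a * (n * ∑ a, J a * f a) := by
      intro a
      rw [← ih]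
      simp only [Fin.prod_univ_succ, Fin.sum_univ_succ, Fin.cons_zero, Fin.cons_succ, mul_add,
        Finset.sum_add_distrib]
      congr 1
      · rw [← Finset.sum_mul, ← Finset.mul_sum, sum_prod_eq_one hJ, mul_one]
      · rw [Finset.mul_sum]
        simp only [mul_assoc]
    simp only [this, Finset.sum_add_distrib, ← Finset.sum_mul, hJ]
    push_cast
    ring

/-- The second moment of a sum of independent centred copies. -/
lemma sum_prod_mul_sum_sq {J : α → ℝ} (hJ : ∑ a, J a = 1) {f : α → ℝ}
    (hf : ∑ a, J a * f a = 0) :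
    ∑ w : Fin n → α, (∏ i, J (w i)) * (∑ i, f (w i)) ^ 2 = n * ∑ a, J a * f a ^ 2 := by
  induction n with
  | zero => simp
  | succ n ih =>
    rw [sum_fin_succ_fun]
    have : ∀ a, ∑ w : Fin n → α, (∏ i, J ((Fin.cons a w : Fin (n + 1) → α) i)) *
        (∑ i, f ((Fin.cons a w : Fin (n + 1) → α) i)) ^ 2 =
        J a * f a ^ 2 + J a * (n * ∑ a, J a * f a ^ 2) := by
      intro a
      have hm := sum_prod_mul_sum (n := n) hJ f
      rw [hf, mul_zero] at hm
      rw [← ih]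
      simp only [Fin.prod_univ_succ, Fin.sum_univ_succ, Fin.cons_zero, Fin.cons_succ]
      calc _ = ∑ w : Fin n → α, (J a * f a ^ 2 * ∏ i, J (w i) +
            2 * J a * f a * ((∏ i, J (w i)) * ∑ i, f (w i)) +
            J a * ((∏ i, J (w i)) * (∑ i, f (w i)) ^ 2)) :=
          Finset.sum_congr rfl fun w _ => by ring
        _ = _ := by
          rw [Finset.sum_add_distrib, Finset.sum_add_distrib, ← Finset.mul_sum, ← Finset.mul_sum,
            ← Finset.mul_sum, hm, sum_prod_eq_one hJ]
          ring
    simp only [this, Finset.sum_add_distrib, ← Finset.sum_mul, hJ]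
    push_cast
    ring

open Classical in
/-- Chebyshev's inequality for a sum of independent copies. -/
lemma chebyshev_prod {J : α → ℝ} (hJ0 : ∀ a, 0 ≤ J a) (hJ : ∑ a, J a = 1) (f : α → ℝ) {μ : ℝ}
    (hμ : ∑ a, J a * f a = μ) (hn : 0 < n) {τ : ℝ} (hτ : 0 < τ) :
    ∑ w : Fin n → α, (if n * (μ + τ) < ∑ i, f (w i) then ∏ i, J (w i) else 0) ≤
      (∑ a, J a * (f a - μ) ^ 2) / (n * τ ^ 2) := by
  have hn' : (0 : ℝ) < n := by exact_mod_cast hn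
  have hc : ∑ a, J a * (f a - μ) = 0 := by
    simp only [mul_sub, Finset.sum_sub_distrib, ← Finset.sum_mul, hJ, hμ]
    ring
  have h2 := sum_prod_mul_sum_sq (n := n) hJ hc
  calc _ ≤ ∑ w : Fin n → α, ((∏ i, J (w i)) * (∑ i, (f (w i) - μ)) ^ 2) / (n * τ) ^ 2 := by
        refine Finset.sum_le_sum fun w _ => ?_
        have hp : 0 ≤ ∏ i, J (w i) := Finset.prod_nonneg fun i _ => hJ0 _
        split_ifs with hw
        · rw [le_div_iff₀ (by positivity)]
          gcongr
          rw [Finset.sum_sub_distrib]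
          simp only [Finset.sum_const, Finset.card_univ, Fintype.card_fin, nsmul_eq_mul]
          linarith
        · positivity
    _ = _ := by
        rw [← Finset.sum_div, h2]
        field_simp

end Product

/-! ### Covering by random codewords -/

/-- After `1 - s / K ≤ exp (-(s / K))`, convexity of `exp` between the values at `s = 0` and `s = 1`
separates `s` from `M / K`. In the covering argument `s` is a conditional probability of success. -/
lemma one_sub_div_pow_le {s K : ℝ} (hs : 0 ≤ s) (hs' : s ≤ 1) (M : ℕ)
    (hsK : 0 ≤ 1 - s / K) : (1 - s / K) ^ M ≤ 1 - s + Real.exp (-(M / K)) := by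
  have h1 : 1 - s / K ≤ Real.exp (-(s / K)) := by
    have := Real.add_one_le_exp (-(s / K)); linarith
  have h2 : (1 - s / K) ^ M ≤ Real.exp (s * (-(M / K)) + (1 - s) * 0) := by
    calc _ ≤ Real.exp (-(s / K)) ^ M := by gcongr
      _ = _ := by rw [← Real.exp_nat_mul]; congr 1; ring
  have h3 := convexOn_exp.2 (Set.mem_univ (-((M : ℝ) / K))) (Set.mem_univ (0 : ℝ)) hs
    (sub_nonneg.2 hs') (by ring)
  simp only [smul_eq_mul, Real.exp_zero, mul_one] at h3
  have h4 : s * Real.exp (-(M / K)) ≤ Real.exp (-(M / K)) :=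
    mul_le_of_le_one_left (Real.exp_pos _).le hs'
  linarith

open Classical in
/-- Some code of `M` words covers the source `p` up to an exponentially small error, if the joint
mass function `j` on the covering relation `T` is at most `K` times the product one. -/
lemma exists_covering {A B : Type*} [Fintype A] [Fintype B] {p : A → ℝ} {q : B → ℝ}
    {j : A → B → ℝ} {T : A → B → Prop} {K : ℝ} (hp0 : ∀ a, 0 ≤ p a) (hp : ∑ a, p a = 1)
    (hq0 : ∀ b, 0 ≤ q b) (hq : ∑ b, q b = 1) (hj0 : ∀ a b, 0 ≤ j a b)
    (hj : ∀ a, ∑ b, j a b = p a) (hK : 0 < K) (hT : ∀ a b, T a b → j a b ≤ K * (p a * q b))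
    (M : ℕ) :
    ∃ c : Fin M → B, ∑ a, (if ∀ m, ¬ T a (c m) then p a else 0) ≤
      (∑ a, ∑ b, if T a b then 0 else j a b) + Real.exp (-(M / K)) := by
  set E := (∑ a, ∑ b, if T a b then 0 else j a b) + Real.exp (-(M / K)) with hE
  -- Random coding: for independent codewords of law `q`, a source word `a` stays uncovered with
  -- probability the `M`-th power of the chance that one codeword misses it.
  have havg : ∑ c : Fin M → B, (∏ m, q (c m)) * ∑ a, (if ∀ m, ¬ T a (c m) then p a else 0) ≤ E := by
    have h1 : ∑ c : Fin M → B, (∏ m, q (c m)) * ∑ a, (if ∀ m, ¬ T a (c m) then p a else 0) =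
        ∑ a, p a * (∑ b, if T a b then 0 else q b) ^ M := by
      simp only [Finset.mul_sum]
      rw [Finset.sum_comm]
      refine Finset.sum_congr rfl fun a _ => ?_
      rw [Fintype.sum_pow, Finset.mul_sum]
      refine Finset.sum_congr rfl fun c _ => ?_
      split_ifs with hc
      · rw [mul_comm]
        congr 1
        exact Finset.prod_congr rfl fun m _ => (if_neg (hc m)).symm
      · push Not at hc
        obtain ⟨m, hm⟩ := hc
        have h0 : ∏ m, (if T a (c m) then 0 else q (c m)) = 0 :=
          Finset.prod_eq_zero (Finset.mem_univ m) (if_pos hm)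
        rw [mul_zero, h0, mul_zero]
    rw [h1]
    have h2 : ∀ a, p a * (∑ b, if T a b then 0 else q b) ^ M ≤
        (∑ b, if T a b then 0 else j a b) + p a * Real.exp (-(M / K)) := by
      intro a
      have hsum : 0 ≤ ∑ b, if T a b then 0 else j a b :=
        Finset.sum_nonneg fun b _ => by split_ifs; exacts [le_rfl, hj0 a b]
      rcases (hp0 a).eq_or_lt with h0 | h0
      · rw [← h0]; simpa using hsum
      -- `s` is the conditional probability of `T` given `a` under `j`. The bound on `T` by the
      -- product law gives a `q`-random codeword probability at least `s / K` of covering `a`.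
      · set s := (∑ b, if T a b then j a b else 0) / p a with hs
        have hsp : p a * s = ∑ b, if T a b then j a b else 0 := by rw [hs]; field_simp
        have hsplit : (∑ b, if T a b then j a b else 0) + (∑ b, if T a b then 0 else j a b)
            = p a := by
          rw [← Finset.sum_add_distrib, ← hj a]
          exact Finset.sum_congr rfl fun b _ => by split_ifs <;> ring
        have hqsplit : (∑ b, if T a b then q b else 0) + (∑ b, if T a b then 0 else q b) = 1 := by
          rw [← Finset.sum_add_distrib, ← hq]
          exact Finset.sum_congr rfl fun b _ => by split_ifs <;> ring
        have hs0 : 0 ≤ s := div_nonneg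
          (Finset.sum_nonneg fun b _ => by split_ifs; exacts [hj0 a b, le_rfl]) h0.le
        have hs1 : s ≤ 1 := by rw [hs, div_le_one h0]; linarith
        have hsK : s / K ≤ ∑ b, if T a b then q b else 0 := by
          rw [hs, div_div, div_le_iff₀ (by positivity), Finset.sum_mul]
          refine Finset.sum_le_sum fun b _ => ?_
          split_ifs with hb
          · have := hT a b hb; linarith
          · simp
        have hq1 : 0 ≤ ∑ b, if T a b then 0 else q b :=
          Finset.sum_nonneg fun b _ => by split_ifs; exacts [le_rfl, hq0 b]
        calc _ ≤ p a * (1 - s / K) ^ M := by gcongr; linarith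
          _ ≤ p a * (1 - s + Real.exp (-(M / K))) := by
            gcongr; exact one_sub_div_pow_le hs0 hs1 M (by linarith)
          _ = _ := by rw [mul_add, mul_sub, hsp]; linarith
    refine (Finset.sum_le_sum fun a _ => h2 a).trans ?_
    rw [Finset.sum_add_distrib, ← Finset.sum_mul, hp, one_mul]
  -- If every code exceeded `E`, so would the average; strictness needs one code `c₀` of positive
  -- weight.
  by_contra! hcon
  have hpos : ∀ c : Fin M → B, 0 ≤ ∏ m, q (c m) := fun c => Finset.prod_nonneg fun m _ => hq0 _
  have hone : ∑ c : Fin M → B, ∏ m, q (c m) = 1 := sum_prod_eq_one hq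
  have hex : ∃ c : Fin M → B, 0 < ∏ m, q (c m) := by
    by_contra! hle
    have := Finset.sum_nonpos fun c (_ : c ∈ Finset.univ) => hle c
    linarith
  obtain ⟨c₀, hc₀⟩ := hex
  have hlt : ∑ c : Fin M → B, (∏ m, q (c m)) * E <
      ∑ c : Fin M → B, (∏ m, q (c m)) * ∑ a, (if ∀ m, ¬ T a (c m) then p a else 0) :=
    Finset.sum_lt_sum (fun c _ => mul_le_mul_of_nonneg_left (hcon c).le (hpos c))
      ⟨c₀, Finset.mem_univ _, mul_lt_mul_of_pos_left (hcon c₀) hc₀⟩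
  rw [← Finset.sum_mul, hone, one_mul] at hlt
  linarith

/-! ### The doubly symmetric binary source -/

/-- The Bernoulli mass function on `{0, 1}`. -/
noncomputable def bern (p : ℝ) (z : Fin 2) : ℝ := if z = 0 then 1 - p else p

lemma bern_nonneg {p : ℝ} (hp : 0 ≤ p) (hp' : p ≤ 1) (z : Fin 2) : 0 ≤ bern p z := by
  unfold bern; split_ifs <;> linarith

lemma bern_pos {p : ℝ} (hp : 0 < p) (hp' : p < 1) (z : Fin 2) : 0 < bern p z := by
  unfold bern; split_ifs <;> linarith

lemma sum_bern (p : ℝ) : ∑ z, bern p z = 1 := by simp [bern, Fin.sum_univ_two]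

lemma sum_bern_mul_logb (p : ℝ) : ∑ z, bern p z * Real.logb 2 (bern p z) = -h p := by
  simp [bern, Fin.sum_univ_two, h]

lemma dsbs_add (p : ℝ) (z y : Fin 2) : dsbs p (z + y, y) = 1 / 2 * bern p z := by
  fin_cases z <;> fin_cases y <;> simp [dsbs, bern] <;> ring

lemma swapped_dsbs (p : ℝ) : swapped (dsbs p) = dsbs p := by
  funext ⟨x, y⟩
  simp [swapped, dsbs, eq_comm]

lemma dsbs_mem_stdSimplex {p : ℝ} (hp : 0 ≤ p) (hp' : p ≤ 1) :
    dsbs p ∈ stdSimplex ℝ (Fin 2 × Fin 2) := by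
  refine ⟨fun xy => ?_, ?_⟩
  · unfold dsbs; split_ifs <;> linarith
  · simp [Fintype.sum_prod_type, dsbs, Fin.sum_univ_two]; ring

lemma fin_two_add_self (a : Fin 2) : a + a = 0 := by fin_cases a <;> rfl

lemma fun_add_add_cancel {n : ℕ} (z y : Fin n → Fin 2) : z + y + y = z := by
  funext i
  simp [add_assoc, fin_two_add_self]

/-- In terms of the independent pair `(X + Y, Y)`, the source is Bernoulli times uniform. -/
lemma expect_dsbs (p : ℝ) (n : ℕ) (F : (Fin n → Fin 2) → (Fin n → Fin 2) → ℝ) :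
    expect (dsbs p) n F =
      (1 / 2) ^ n * ∑ y, ∑ z : Fin n → Fin 2, (∏ i, bern p (z i)) * F (z + y) y := by
  unfold expect
  rw [Finset.sum_comm, Finset.mul_sum]
  refine Finset.sum_congr rfl fun y _ => ?_
  rw [← Equiv.sum_comp (Equiv.addRight y), Finset.mul_sum]
  refine Finset.sum_congr rfl fun z _ => ?_
  simp only [Equiv.coe_addRight, Pi.add_apply, dsbs_add, Finset.prod_mul_distrib,
    Finset.prod_const, Finset.card_univ, Fintype.card_fin]
  ring

lemma half_pow_mul_card (n : ℕ) (c : ℝ) : (1 / 2 : ℝ) ^ n * ∑ _y : Fin n → Fin 2, c = c := by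
  simp only [Finset.sum_const, Finset.card_univ, Fintype.card_fun, Fintype.card_fin, nsmul_eq_mul]
  push_cast
  rw [← mul_assoc, ← mul_pow]
  norm_num

/-! ### Converse -/

/-- Gibbs' inequality. -/
lemma gibbs {A : Type*} [Fintype A] {p r : A → ℝ} (hp : ∀ a, 0 < p a) (hr : ∀ a, 0 < r a)
    (hsum : ∑ a, r a ≤ ∑ a, p a) :
    ∑ a, p a * Real.logb 2 (r a) ≤ ∑ a, p a * Real.logb 2 (p a) := by
  have hl : 0 < Real.log 2 := Real.log_pos one_lt_two
  have h1 : ∀ a, p a * Real.logb 2 (r a) ≤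
      p a * Real.logb 2 (p a) + (r a - p a) / Real.log 2 := by
    intro a
    have h2 := Real.log_le_sub_one_of_pos (div_pos (hr a) (hp a))
    rw [Real.log_div (hr a).ne' (hp a).ne'] at h2
    have h3 := mul_le_mul_of_nonneg_left h2 (hp a).le
    have h4 : p a * (r a / p a - 1) = r a - p a := by have := (hp a).ne'; field_simp
    rw [h4] at h3
    have h5 : p a * Real.log (r a) / Real.log 2 ≤
        (p a * Real.log (p a) + (r a - p a)) / Real.log 2 := by
      gcongr; linarith
    calc _ = p a * Real.log (r a) / Real.log 2 := by rw [Real.logb]; ring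
      _ ≤ _ := h5
      _ = _ := by rw [Real.logb]; ring
  refine (Finset.sum_le_sum fun a _ => h1 a).trans ?_
  rw [Finset.sum_add_distrib, ← Finset.sum_div, Finset.sum_sub_distrib]
  have : (∑ a, r a - ∑ a, p a) / Real.log 2 ≤ 0 :=
    div_nonpos_of_nonpos_of_nonneg (by linarith) hl.le
  linarith

lemma logb_prod_bern {n : ℕ} {D : ℝ} (hD : 0 < D) (hD' : D < 1) (z : Fin n → Fin 2) :
    Real.logb 2 (∏ i, bern D (z i)) = ∑ i, Real.logb 2 (bern D (z i)) :=
  Real.logb_prod _ _ fun _ _ => (bern_pos hD hD' _).ne'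

lemma sum_logb_bern_add {n : ℕ} (D : ℝ) (x x' : Fin n → Fin 2) :
    ∑ i, Real.logb 2 (bern D ((x + x') i)) =
      n * (Real.logb 2 (1 - D) - hSlope D * seqDist hamming x x') := by
  have h1 : ∀ a b : Fin 2, Real.logb 2 (bern D (a + b)) =
      Real.logb 2 (1 - D) - hSlope D * hamming a b := by
    intro a b
    fin_cases a <;> fin_cases b <;> simp [bern, hamming, hSlope]
  simp only [Pi.add_apply, h1, Finset.sum_sub_distrib, ← Finset.mul_sum, seqDist,
    Finset.sum_const, Finset.card_univ, Fintype.card_fin, nsmul_eq_mul]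
  rcases n.eq_zero_or_pos with rfl | hn
  · simp
  · have : (n : ℝ) ≠ 0 := by exact_mod_cast hn.ne'
    field_simp

lemma Code.size_pos {n : ℕ} (c : Code (Fin 2) (Fin 2) (Fin 2) (Fin 2) n) : 0 < c.size :=
  (c.enc 0 0).pos

/-- The number of messages in terms of the distortion at the first decoder. -/
lemma le_logb_size {p D : ℝ} (hp : 0 < p) (hp' : p < 1) (hD : 0 < D) (hD' : D < 1) {n : ℕ}
    (c : Code (Fin 2) (Fin 2) (Fin 2) (Fin 2) n) :
    n * (h p + Real.logb 2 (1 - D) - hSlope D *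
      expect (dsbs p) n fun x y => seqDist hamming x (c.dec₁ (c.enc x y) y)) ≤
      Real.logb 2 c.size := by
  have hM : (0 : ℝ) < c.size := by exact_mod_cast c.size_pos
  set dist : (Fin n → Fin 2) → (Fin n → Fin 2) → ℝ :=
    fun x y => seqDist hamming x (c.dec₁ (c.enc x y) y) with hdist
  set π : (Fin n → Fin 2) → ℝ := fun z => ∏ i, bern p (z i) with hπ
  have hπ1 : ∑ z, π z = 1 := sum_prod_eq_one (sum_bern p)
  have key : ∀ y, n * (h p + Real.logb 2 (1 - D)) - n * hSlope D * ∑ z, π z * dist (z + y) y ≤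
      Real.logb 2 c.size := by
    intro y
    set e : (Fin n → Fin 2) → (Fin n → Fin 2) :=
      fun z => (z + y) + c.dec₁ (c.enc (z + y) y) y with he
    -- Trial law: uniform message and independent Bernoulli(`D`) error, pulled back along the
    -- injection from `z` to message and error. Its total mass is at most 1.
    set r : (Fin n → Fin 2) → ℝ := fun z => (c.size : ℝ)⁻¹ * ∏ i, bern D (e z i) with hr
    have hinj : Function.Injective fun z => (c.enc (z + y) y, e z) := by
      intro z z' hzz
      simp only [Prod.mk.injEq, he] at hzz
      rw [hzz.1] at hzz
      exact add_right_cancel (add_right_cancel hzz.2)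
    have hsum : ∑ z, r z ≤ ∑ z, π z := by
      have h1 : ∑ me : Fin c.size × (Fin n → Fin 2), (c.size : ℝ)⁻¹ * ∏ i, bern D (me.2 i) = 1 := by
        rw [Fintype.sum_prod_type]
        simp only [← Finset.mul_sum, sum_prod_eq_one (sum_bern D)]
        simp [hM.ne']
      rw [hπ1, ← h1]
      calc ∑ z, r z = ∑ me ∈ Finset.univ.map ⟨_, hinj⟩,
            (c.size : ℝ)⁻¹ * ∏ i, bern D (me.2 i) := by rw [Finset.sum_map]; rfl
        _ ≤ _ := Finset.sum_le_univ_sum_of_nonneg fun me =>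
            mul_nonneg (inv_nonneg.2 hM.le) (Finset.prod_nonneg fun i _ => (bern_pos hD hD' _).le)
    have hpos : ∀ {s : ℝ}, 0 < s → s < 1 → ∀ w : Fin n → Fin 2, 0 < ∏ i, bern s (w i) :=
      fun hs hs' w => Finset.prod_pos fun i _ => bern_pos hs hs' _
    have hg := gibbs (p := π) (r := r) (hpos hp hp')
      (fun z => mul_pos (inv_pos.2 hM) (hpos hD hD' _)) hsum
    have hR : ∑ z, π z * Real.logb 2 (π z) = -(n * h p) := by
      simp only [hπ, logb_prod_bern hp hp']
      rw [sum_prod_mul_sum (sum_bern p) fun z => Real.logb 2 (bern p z), sum_bern_mul_logb]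
      ring
    have hL : ∑ z, π z * Real.logb 2 (r z) = -Real.logb 2 c.size + n * Real.logb 2 (1 - D) -
        n * hSlope D * ∑ z, π z * dist (z + y) y := by
      have : ∀ z, π z * Real.logb 2 (r z) = (-Real.logb 2 c.size + n * Real.logb 2 (1 - D)) * π z
          - n * hSlope D * (π z * dist (z + y) y) := by
        intro z
        simp only [hr]
        rw [Real.logb_mul (inv_ne_zero hM.ne') (hpos hD hD' _).ne', Real.logb_inv,
          logb_prod_bern hD hD', he, sum_logb_bern_add]
        simp only [hdist]
        ring
      simp only [this, Finset.sum_sub_distrib, ← Finset.mul_sum, hπ1, mul_one]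
    rw [hR, hL] at hg
    linarith
  have hav : (1 / 2 : ℝ) ^ n * ∑ y : Fin n → Fin 2, (n * (h p + Real.logb 2 (1 - D)) -
      n * hSlope D * ∑ z, π z * dist (z + y) y) ≤
      (1 / 2 : ℝ) ^ n * ∑ _y : Fin n → Fin 2, Real.logb 2 c.size := by
    gcongr with y
    exact key y
  rw [half_pow_mul_card, Finset.sum_sub_distrib, mul_sub, half_pow_mul_card,
    ← Finset.mul_sum] at hav
  rw [expect_dsbs]
  refine le_trans (le_of_eq ?_) hav
  ring

/-- An achievable rate is at least `h p - h Δ`. -/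
lemma le_of_isAchievable {p Δ R : ℝ} (hp : 0 < p) (hp' : p < 1 / 2) (hΔ : 0 ≤ Δ) (hΔp : Δ < p)
    (hR : IsAchievable (dsbs p) hamming hamming Δ Δ R) : h p - h Δ ≤ R := by
  obtain ⟨c, hrate, hdist, -⟩ := hR
  -- Working at `D > Δ` makes the distortion eventually less than `D`, and keeps the slope of `h`
  -- finite when `Δ = 0`; continuity of `h` then lets `D` tend to `Δ`.
  have key : ∀ D, Δ < D → D < p → h p - h D ≤ R := by
    intro D hD hDp
    have hD0 : 0 < D := hΔ.trans_lt hD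
    have hev := Filter.eventually_lt_of_limsup_lt (hdist.trans_lt (EReal.coe_lt_coe_iff.2 hD))
    rw [← EReal.coe_le_coe_iff]
    refine le_trans (Filter.le_limsup_of_frequently_le ?_) hrate
    refine Filter.Eventually.frequently ?_
    filter_upwards [hev, Filter.eventually_gt_atTop 0] with n hn hn0
    rw [EReal.coe_lt_coe_iff] at hn
    rw [EReal.coe_le_coe_iff]
    have hn' : (0 : ℝ) < n := by exact_mod_cast hn0
    rw [le_div_iff₀ hn', mul_comm]
    refine le_trans ?_ (le_logb_size hp (by linarith) hD0 (by linarith) (c n))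
    refine mul_le_mul_of_nonneg_left ?_ hn'.le
    have h1 := mul_le_mul_of_nonneg_left hn.le (hSlope_pos hD0 (by linarith)).le
    have h2 : h D = -Real.logb 2 (1 - D) + hSlope D * D := by simp only [h, hSlope]; ring
    linarith
  have ht : Filter.Tendsto (fun D => h p - h D) (nhdsWithin Δ (Set.Ioi Δ)) (nhds (h p - h Δ)) :=
    ((continuous_const.sub continuous_h).tendsto Δ).mono_left nhdsWithin_le_nhds
  refine le_of_tendsto ht ?_
  filter_upwards [Ioo_mem_nhdsGT hΔp] with D hD using key D hD.1 hD.2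

/-! ### Achievability -/

/-- The joint mass function of a binary source and its reproduction: the reproduction is
Bernoulli, and the source results from it through a binary symmetric channel. -/
noncomputable def testJoint (q Δ : ℝ) (zb : Fin 2 × Fin 2) : ℝ := bern q zb.2 * bern Δ (zb.1 + zb.2)

/-- The logarithm of the likelihood ratio of the channel and the source. -/
noncomputable def logRatio (p Δ : ℝ) (zb : Fin 2 × Fin 2) : ℝ :=
  Real.logb 2 (bern Δ (zb.1 + zb.2)) - Real.logb 2 (bern p zb.1)

/-- The equation `hq` says that a Bernoulli(`q`) input to a binary symmetric channel of crossover
`Δ` has a Bernoulli(`p`) output. -/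
lemma sum_testJoint {p q Δ : ℝ} (hq : q * (1 - 2 * Δ) = p - Δ) (z : Fin 2) :
    ∑ b, testJoint q Δ (z, b) = bern p z := by
  fin_cases z <;> simp [testJoint, bern, Fin.sum_univ_two] <;> linarith

lemma sum_testJoint_eq_one (q Δ : ℝ) : ∑ zb, testJoint q Δ zb = 1 := by
  simp [Fintype.sum_prod_type, testJoint, bern, Fin.sum_univ_two]
  ring

lemma sum_testJoint_mul_hamming (q Δ : ℝ) :
    ∑ zb, testJoint q Δ zb * hamming zb.1 zb.2 = Δ := by
  simp [Fintype.sum_prod_type, testJoint, bern, Fin.sum_univ_two, hamming]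
  ring

lemma sum_testJoint_mul_logRatio {p q Δ : ℝ} (hq : q * (1 - 2 * Δ) = p - Δ) :
    ∑ zb, testJoint q Δ zb * logRatio p Δ zb = h p - h Δ := by
  have hp : p = q * (1 - 2 * Δ) + Δ := by linarith
  have h1 : h p = -(q * (1 - 2 * Δ) + Δ) * Real.logb 2 p -
      (1 - (q * (1 - 2 * Δ) + Δ)) * Real.logb 2 (1 - p) := by rw [← hp]; rfl
  rw [h1]
  simp [Fintype.sum_prod_type, testJoint, logRatio, bern, Fin.sum_univ_two, h]
  ring

/-- Positivity is essential: `Real.logb 2 0 = 0`, so the identity fails at the zero transition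
probabilities of `Δ = 0`. -/
lemma bern_eq_mul_rpow_logRatio {p Δ : ℝ} (hp : 0 < p) (hp' : p < 1) {z b : Fin 2}
    (hb : 0 < bern Δ (z + b)) : bern Δ (z + b) = 2 ^ logRatio p Δ (z, b) * bern p z := by
  have hz := bern_pos hp hp' z
  simp only [logRatio]
  rw [Real.rpow_sub two_pos, Real.rpow_logb two_pos (by norm_num) hb,
    Real.rpow_logb two_pos (by norm_num) hz]
  field_simp

lemma sum_sum_eq_sum_pairs {α β : Type*} [Fintype α] [Fintype β] {n : ℕ}
    (G : (Fin n → α) → (Fin n → β) → ℝ) :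
    ∑ x, ∑ y, G x y = ∑ w : Fin n → α × β, G (fun i => (w i).1) (fun i => (w i).2) := by
  rw [← Fintype.sum_prod_type' G,
    ← Equiv.sum_comp (Equiv.arrowProdEquivProdArrow (Fin n) (fun _ => α) (fun _ => β))]
  rfl

open Classical in
/-- A covering of the Bernoulli source in Hamming distance. -/
lemma exists_hamming_covering {p Δ : ℝ} (hp' : p < 1 / 2) (hΔ : 0 ≤ Δ) (hΔp : Δ < p) :
    ∃ V : ℝ, ∀ n : ℕ, 0 < n → ∀ τ : ℝ, 0 < τ → ∀ M : ℕ, ∃ c : Fin M → Fin n → Fin 2,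
      ∑ z : Fin n → Fin 2, (if ∀ m, ¬ seqDist hamming z (c m) ≤ Δ + τ then ∏ i, bern p (z i) else 0)
        ≤ V / (n * τ ^ 2) + Real.exp (-(M / 2 ^ (n * (h p - h Δ + τ)))) := by
  have hp : 0 < p := hΔ.trans_lt hΔp
  have hD : 0 < 1 - 2 * Δ := by linarith
  set q := (p - Δ) / (1 - 2 * Δ) with hqdef
  have hq : q * (1 - 2 * Δ) = p - Δ := div_mul_cancel₀ _ hD.ne'
  have hq0 : 0 ≤ q := div_nonneg (by linarith) hD.le
  have hq1 : q ≤ 1 := by rw [hqdef, div_le_one hD]; linarith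
  have hJ0 : ∀ zb, 0 ≤ testJoint q Δ zb := fun zb =>
    mul_nonneg (bern_nonneg hq0 hq1 _) (bern_nonneg hΔ (by linarith) _)
  have hJ1 := sum_testJoint_eq_one q Δ
  refine ⟨(∑ zb, testJoint q Δ zb * (hamming zb.1 zb.2 - Δ) ^ 2) +
    ∑ zb, testJoint q Δ zb * (logRatio p Δ zb - (h p - h Δ)) ^ 2, fun n hn τ hτ M => ?_⟩
  have hn' : (0 : ℝ) < n := by exact_mod_cast hn
  -- Typical pairs: small distortion and small log-likelihood ratio. The positivity clause discards
  -- only pairs of `testJoint`-mass zero, so the failure probability is controlled by the two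
  -- Chebyshev bounds whose variances add up to `V`.
  set T : (Fin n → Fin 2) → (Fin n → Fin 2) → Prop := fun z b =>
    seqDist hamming z b ≤ Δ + τ ∧ (∀ i, 0 < bern Δ (z i + b i)) ∧
      ∑ i, logRatio p Δ (z i, b i) ≤ n * (h p - h Δ + τ) with hTdef
  have hT : ∀ z b, T z b → ∏ i, testJoint q Δ (z i, b i) ≤
      2 ^ (n * (h p - h Δ + τ)) * ((∏ i, bern p (z i)) * ∏ i, bern q (b i)) := by
    rintro z b ⟨-, hpos, hlog⟩
    have h1 : ∏ i, bern Δ (z i + b i) =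
        2 ^ (∑ i, logRatio p Δ (z i, b i)) * ∏ i, bern p (z i) := by
      rw [Real.rpow_sum_of_pos two_pos, ← Finset.prod_mul_distrib]
      exact Finset.prod_congr rfl fun i _ => bern_eq_mul_rpow_logRatio hp (by linarith) (hpos i)
    have h2 : 0 ≤ ∏ i, bern q (b i) := Finset.prod_nonneg fun i _ => bern_nonneg hq0 hq1 _
    have h3 : 0 ≤ ∏ i, bern p (z i) :=
      Finset.prod_nonneg fun i _ => bern_nonneg hp.le (by linarith) _
    have h4 : (2 : ℝ) ^ (∑ i, logRatio p Δ (z i, b i)) ≤ 2 ^ (n * (h p - h Δ + τ)) :=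
      Real.rpow_le_rpow_of_exponent_le one_le_two hlog
    simp only [testJoint, Finset.prod_mul_distrib]
    rw [h1]
    calc _ = 2 ^ (∑ i, logRatio p Δ (z i, b i)) *
          ((∏ i, bern p (z i)) * ∏ i, bern q (b i)) := by ring
      _ ≤ _ := by gcongr
  obtain ⟨c, hc⟩ := exists_covering (p := fun z : Fin n → Fin 2 => ∏ i, bern p (z i))
    (q := fun b : Fin n → Fin 2 => ∏ i, bern q (b i))
    (j := fun z b => ∏ i, testJoint q Δ (z i, b i)) (T := T)
    (K := 2 ^ (n * (h p - h Δ + τ)))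
    (fun z => Finset.prod_nonneg fun i _ => bern_nonneg hp.le (by linarith) _)
    (sum_prod_eq_one (sum_bern p))
    (fun b => Finset.prod_nonneg fun i _ => bern_nonneg hq0 hq1 _)
    (sum_prod_eq_one (sum_bern q))
    (fun z b => Finset.prod_nonneg fun i _ => hJ0 _)
    (fun z => by
      have := Finset.prod_univ_sum (fun _ : Fin n => (Finset.univ : Finset (Fin 2)))
        (fun i b => testJoint q Δ (z i, b))
      rw [Fintype.piFinset_univ] at this
      rw [← this]
      exact Finset.prod_congr rfl fun i _ => sum_testJoint hq _)
    (by positivity) hT M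
  refine ⟨c, le_trans ?_ (hc.trans ?_)⟩
  · refine Finset.sum_le_sum fun z _ => ?_
    have hz : 0 ≤ ∏ i, bern p (z i) :=
      Finset.prod_nonneg fun i _ => bern_nonneg hp.le (by linarith) _
    split_ifs with h1 h2 h2
    · exact le_rfl
    · exact absurd (fun m hm => h1 m hm.1) h2
    · exact hz
    · exact le_rfl
  · refine add_le_add_left ?_ _
    rw [sum_sum_eq_sum_pairs, add_div]
    refine le_trans ?_ (add_le_add
      (chebyshev_prod (n := n) hJ0 hJ1 (fun zb => hamming zb.1 zb.2)
        (sum_testJoint_mul_hamming q Δ) hn hτ)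
      (chebyshev_prod (n := n) hJ0 hJ1 (logRatio p Δ) (sum_testJoint_mul_logRatio hq) hn hτ))
    rw [← Finset.sum_add_distrib]
    refine Finset.sum_le_sum fun w _ => ?_
    have hw : 0 ≤ ∏ i, testJoint q Δ (w i) := Finset.prod_nonneg fun i _ => hJ0 _
    have hite : ∀ a : Prop, 0 ≤ if a then ∏ i, testJoint q Δ (w i) else 0 := fun a => by
      split_ifs; exacts [hw, le_rfl]
    by_cases hTw : T (fun i => (w i).1) (fun i => (w i).2)
    · rw [if_pos hTw]
      exact add_nonneg (hite _) (hite _)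
    · rw [if_neg hTw]
      by_cases h1 : n * (Δ + τ) < ∑ i, hamming (w i).1 (w i).2
      · rw [if_pos h1]
        exact le_add_of_nonneg_right (hite _)
      by_cases h2 : n * (h p - h Δ + τ) < ∑ i, logRatio p Δ (w i)
      · rw [if_pos h2]
        exact le_add_of_nonneg_left (hite _)
      have h3 : ¬ ∀ i, 0 < bern Δ ((w i).1 + (w i).2) := fun h3 => hTw
        ⟨by rw [seqDist, div_le_iff₀ hn', mul_comm]; exact not_lt.1 h1, h3, not_lt.1 h2⟩
      push Not at h3
      obtain ⟨i, hi⟩ := h3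
      have h0 : bern Δ ((w i).1 + (w i).2) = 0 :=
        le_antisymm hi (bern_nonneg hΔ (by linarith) _)
      have h4 : ∏ i, testJoint q Δ (w i) = 0 :=
        Finset.prod_eq_zero (Finset.mem_univ i) (by rw [testJoint, h0, mul_zero])
      rw [if_neg h1, if_neg h2, add_zero]
      exact h4.le

lemma hamming_add_right (x y a : Fin 2) : hamming x (y + a) = hamming (x + y) a := by
  fin_cases x <;> fin_cases y <;> fin_cases a <;> simp [hamming]

lemma seqDist_hamming_add {n : ℕ} (x y a : Fin n → Fin 2) :
    seqDist hamming x (y + a) = seqDist hamming (x + y) a := by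
  simp [seqDist, hamming_add_right]

lemma seqDist_hamming_le_one {n : ℕ} (x y : Fin n → Fin 2) : seqDist hamming x y ≤ 1 := by
  refine div_le_one_of_le₀ ?_ n.cast_nonneg
  calc _ ≤ ∑ _i : Fin n, (1 : ℝ) :=
        Finset.sum_le_sum fun i _ => by unfold hamming; split_ifs <;> norm_num
    _ = n := by simp

open Classical in
/-- A covering of the sum of the two sequences gives a complementary delivery code. -/
lemma exists_code {p : ℝ} (hp : 0 ≤ p) (hp' : p ≤ 1) {n M : ℕ} (hM : 0 < M) {r E : ℝ} (hr : 0 ≤ r)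
    (c : Fin M → Fin n → Fin 2)
    (hc : ∑ z : Fin n → Fin 2, (if ∀ m, ¬ seqDist hamming z (c m) ≤ r then ∏ i, bern p (z i) else 0)
      ≤ E) :
    ∃ C : Code (Fin 2) (Fin 2) (Fin 2) (Fin 2) n, C.size = M ∧
      (expect (dsbs p) n fun x y => seqDist hamming x (C.dec₁ (C.enc x y) y)) ≤ r + E ∧
      (expect (dsbs p) n fun x y => seqDist hamming y (C.dec₂ (C.enc x y) x)) ≤ r + E := by
  -- On uncovered words the index is arbitrary, which costs at most 1 in distortion.
  set f : (Fin n → Fin 2) → Fin M := fun z =>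
    if hz : ∃ m, seqDist hamming z (c m) ≤ r then hz.choose else ⟨0, hM⟩ with hf
  have hdist : ∀ z, seqDist hamming z (c (f z)) ≤
      r + if ∀ m, ¬ seqDist hamming z (c m) ≤ r then 1 else 0 := by
    intro z
    by_cases hz : ∃ m, seqDist hamming z (c m) ≤ r
    · have hfz : f z = hz.choose := dif_pos hz
      rw [if_neg (by push Not; exact hz.imp fun m hm => hm), hfz, add_zero]
      exact hz.choose_spec
    · rw [if_pos (by push Not at hz ⊢; exact hz)]
      linarith [seqDist_hamming_le_one z (c (f z))]
  have hexp : (expect (dsbs p) n fun x y => seqDist hamming (x + y) (c (f (x + y)))) ≤ r + E := by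
    rw [expect_dsbs]
    simp only [fun_add_add_cancel]
    rw [half_pow_mul_card]
    have h1 : ∑ z : Fin n → Fin 2, (∏ i, bern p (z i)) * r = r := by
      rw [← Finset.sum_mul, sum_prod_eq_one (sum_bern p), one_mul]
    refine le_trans ?_ (add_le_add h1.le hc)
    rw [← Finset.sum_add_distrib]
    refine Finset.sum_le_sum fun z _ => ?_
    have hz : 0 ≤ ∏ i, bern p (z i) := Finset.prod_nonneg fun i _ => bern_nonneg hp hp' _
    refine (mul_le_mul_of_nonneg_left (hdist z) hz).trans (le_of_eq ?_)
    rw [mul_add, mul_ite, mul_one, mul_zero]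
  -- The single index for `x + y` serves both decoders, each adding the sequence it knows.
  refine ⟨⟨M, fun x y => f (x + y), fun m y => y + c m, fun m x => x + c m⟩, rfl, ?_, ?_⟩
  · simpa only [seqDist_hamming_add] using hexp
  · simpa only [seqDist_hamming_add, add_comm] using hexp

/-- Every rate above `h p - h Δ` is achievable. -/
lemma isAchievable_of_lt {p Δ R : ℝ} (hp' : p < 1 / 2) (hΔ : 0 ≤ Δ) (hΔp : Δ < p)
    (hR : h p - h Δ < R) : IsAchievable (dsbs p) hamming hamming Δ Δ R := by
  have hp : 0 < p := hΔ.trans_lt hΔp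
  have hR0 : 0 < R := (sub_pos.2 (h_lt_h hΔ hΔp hp'.le)).trans hR
  obtain ⟨V, hV⟩ := exists_hamming_covering hp' hΔ hΔp
  set M : ℕ → ℕ := fun n => ⌈(2 : ℝ) ^ (n * R)⌉₊ with hM
  have hM0 : ∀ n, 0 < M n := fun n => Nat.ceil_pos.2 (by positivity)
  -- The exponent makes `τ n` tend to 0 while `n * τ n ^ 2 = √n` still tends to infinity, as
  -- Chebyshev requires.
  set τ : ℕ → ℝ := fun n => (n : ℝ) ^ (-(1 / 4) : ℝ) with hτ
  set err : ℕ → ℝ := fun n => V / (n * τ n ^ 2) +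
    Real.exp (-(M n / 2 ^ (n * (h p - h Δ + τ n)))) with herr
  have hcode : ∀ n, ∃ C : Code (Fin 2) (Fin 2) (Fin 2) (Fin 2) n, 0 < n → C.size = M n ∧
      (expect (dsbs p) n fun x y => seqDist hamming x (C.dec₁ (C.enc x y) y)) ≤
        Δ + τ n + err n ∧
      (expect (dsbs p) n fun x y => seqDist hamming y (C.dec₂ (C.enc x y) x)) ≤
        Δ + τ n + err n := by
    intro n
    rcases n.eq_zero_or_pos with hn | hn
    · exact ⟨⟨1, 0, 0, 0⟩, fun h => absurd h (by omega)⟩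
    · have hn' : (0 : ℝ) < n := by exact_mod_cast hn
      have hτn : 0 < τ n := Real.rpow_pos_of_pos hn' _
      obtain ⟨c, hc⟩ := hV n hn (τ n) hτn (M n)
      obtain ⟨C, hC⟩ := exists_code hp.le (by linarith) (hM0 n) (by linarith) c hc
      exact ⟨C, fun _ => hC⟩
  choose C hC using hcode
  have hτ0 : Filter.Tendsto τ Filter.atTop (nhds 0) :=
    (tendsto_rpow_neg_atTop (by norm_num)).comp tendsto_natCast_atTop_atTop
  have herr0 : Filter.Tendsto err Filter.atTop (nhds 0) := by
    rw [← add_zero (0 : ℝ)]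
    refine Filter.Tendsto.add ?_ ?_
    · have h1 : Filter.Tendsto (fun n : ℕ => V * (n : ℝ) ^ (-(1 / 2) : ℝ)) Filter.atTop
          (nhds (V * 0)) :=
        ((tendsto_rpow_neg_atTop (by norm_num)).comp tendsto_natCast_atTop_atTop).const_mul V
      rw [mul_zero] at h1
      refine h1.congr' ?_
      filter_upwards [Filter.eventually_gt_atTop 0] with n hn
      have hn' : (0 : ℝ) < n := by exact_mod_cast hn
      simp only [hτ]
      rw [← Real.rpow_natCast, ← Real.rpow_mul hn'.le, div_eq_mul_inv]
      congr 1
      nth_rewrite 2 [← Real.rpow_one (n : ℝ)]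
      rw [← Real.rpow_add hn', ← Real.rpow_neg hn'.le]
      norm_num
    · refine Real.tendsto_exp_neg_atTop_nhds_zero.comp ?_
      -- Half of the rate surplus absorbs `τ n`; the other half makes `M n / K` grow exponentially.
      have hε : 0 < (R - (h p - h Δ)) / 2 := by linarith
      have h1 : Filter.Tendsto (fun n : ℕ => (2 : ℝ) ^ (n * ((R - (h p - h Δ)) / 2)))
          Filter.atTop Filter.atTop := by
        refine (tendsto_rpow_atTop_of_base_gt_one 2 one_lt_two).comp ?_
        exact tendsto_natCast_atTop_atTop.atTop_mul_const hε
      refine Filter.tendsto_atTop_mono' _ ?_ h1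
      filter_upwards [hτ0.eventually (gt_mem_nhds hε)] with n hn
      rw [le_div_iff₀ (by positivity), ← Real.rpow_add two_pos]
      refine le_trans ?_ (Nat.le_ceil _)
      refine Real.rpow_le_rpow_of_exponent_le one_le_two ?_
      rw [← mul_add]
      refine mul_le_mul_of_nonneg_left ?_ n.cast_nonneg
      linarith
  have hlim : Filter.Tendsto (fun n => ((Δ + τ n + err n : ℝ) : EReal)) Filter.atTop
      (nhds (Δ : EReal)) := by
    refine (continuous_coe_real_ereal.tendsto Δ).comp ?_
    simpa using (tendsto_const_nhds.add hτ0).add herr0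
  refine ⟨C, ?_, ?_, ?_⟩
  -- Rounding up to an integer at most doubles the number of messages, hence costs at most `1 / n`
  -- in rate.
  · have h1 : Filter.Tendsto (fun n : ℕ => ((R + 1 / n : ℝ) : EReal)) Filter.atTop
        (nhds (R : EReal)) := by
      refine (continuous_coe_real_ereal.tendsto R).comp ?_
      simpa using (tendsto_const_nhds (x := R)).add (tendsto_one_div_atTop_nhds_zero_nat (𝕜 := ℝ))
    rw [← h1.limsup_eq]
    refine Filter.limsup_le_limsup ?_
    filter_upwards [Filter.eventually_gt_atTop 0] with n hn
    rw [EReal.coe_le_coe_iff, (hC n hn).1]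
    have hn' : (0 : ℝ) < n := by exact_mod_cast hn
    have h2 : (1 : ℝ) ≤ 2 ^ (n * R) := Real.one_le_rpow one_le_two (by positivity)
    have h3 : (M n : ℝ) ≤ 2 ^ (n * R + 1) := by
      rw [Real.rpow_add two_pos, Real.rpow_one]
      linarith [(Nat.ceil_lt_add_one (zero_le_one.trans h2)).le]
    have h4 : Real.logb 2 (M n) ≤ n * R + 1 := by
      rw [Real.logb_le_iff_le_rpow one_lt_two (by exact_mod_cast hM0 n)]
      exact h3
    rw [div_le_iff₀ hn', add_mul, one_div, inv_mul_cancel₀ hn'.ne']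
    linarith
  · rw [← hlim.limsup_eq]
    refine Filter.limsup_le_limsup ?_
    filter_upwards [Filter.eventually_gt_atTop 0] with n hn
    exact EReal.coe_le_coe_iff.2 (hC n hn).2.1
  · rw [← hlim.limsup_eq]
    refine Filter.limsup_le_limsup ?_
    filter_upwards [Filter.eventually_gt_atTop 0] with n hn
    exact EReal.coe_le_coe_iff.2 (hC n hn).2.2

lemma achievableRates_nonempty {p Δ : ℝ} (hp' : p < 1 / 2) (hΔ : 0 ≤ Δ) (hΔp : Δ < p) :
    (achievableRates (dsbs p) hamming hamming Δ Δ).Nonempty :=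
  ⟨_, isAchievable_of_lt hp' hΔ hΔp (lt_add_one _)⟩

/-- The optimal rate of lossy complementary delivery of the doubly symmetric binary source. -/
lemma optimalRate_dsbs {p Δ : ℝ} (hp' : p < 1 / 2) (hΔ : 0 ≤ Δ) (hΔp : Δ < p) :
    optimalRate (dsbs p) hamming hamming Δ Δ = h p - h Δ := by
  have hlb : ∀ R ∈ achievableRates (dsbs p) hamming hamming Δ Δ, h p - h Δ ≤ R :=
    fun R hR => le_of_isAchievable (hΔ.trans_lt hΔp) hp' hΔ hΔp hR
  refine le_antisymm (le_of_forall_gt_imp_ge_of_dense fun R hR => ?_)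
    (le_csInf (achievableRates_nonempty hp' hΔ hΔp) hlb)
  exact csInf_le ⟨_, hlb⟩ (isAchievable_of_lt hp' hΔ hΔp hR)

/-! ### The Wyner–Ziv rate -/

/-- The entropy function of a mass function with two atoms, not necessarily normalized. -/
noncomputable def entropyTwo (a b : ℝ) : ℝ := -(a * Real.logb 2 a) - b * Real.logb 2 b

/-- With `m = P(U = u)`, the term `m * Real.logb 2 m` occurs in both joint entropies and cancels in
their difference. The convention for `Real.logb 2 0` covers `t = 0` and `t = 1`. -/
lemma entropyTwo_mul {m : ℝ} (hm : m ≠ 0) (t : ℝ) :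
    entropyTwo (m * (1 - t)) (m * t) = m * h t - m * Real.logb 2 m := by
  have h1 : ∀ s : ℝ, m * s * Real.logb 2 (m * s) =
      m * s * Real.logb 2 m + m * s * Real.logb 2 s := by
    intro s
    rcases eq_or_ne s 0 with rfl | hs
    · simp
    · rw [Real.logb_mul hm hs]; ring
  rw [entropyTwo, h1, h1, h]
  ring

/-- The crossover probability of two binary symmetric channels in series. -/
noncomputable def bconv (p t : ℝ) : ℝ := p * (1 - t) + (1 - p) * t

lemma bconv_one_sub (p t : ℝ) : bconv p (1 - t) = 1 - bconv p t := by
  unfold bconv; ring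

/-- The gap between the Wyner–Ziv test channel and the tangent of `h p - h ·` at `Δ` is positive. -/
lemma wz_gap_pos {p Δ t : ℝ} (hp' : p < 1 / 2) (hΔ : 0 < Δ) (hΔp : Δ < p)
    (ht : 0 ≤ t) (ht' : t ≤ 1) :
    0 < h (bconv p t) - h t - (h p - h Δ) + hSlope Δ * (min (min t (1 - t)) p - Δ) := by
  wlog htt : t ≤ 1 / 2 generalizing t
  · have := this (t := 1 - t) (by linarith) (by linarith) (by linarith)
    rwa [bconv_one_sub, h_one_sub, h_one_sub, sub_sub_cancel, min_comm (1 - t) t] at this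
  have hp : 0 < p := hΔ.trans hΔp
  rw [min_eq_left (show t ≤ 1 - t by linarith)]
  have hb1 : bconv p t ≤ 1 / 2 := by
    have : 0 ≤ (1 - 2 * p) * (1 - 2 * t) := mul_nonneg (by linarith) (by linarith)
    unfold bconv; linarith
  -- For `t ≤ p` the gap is `h (bconv p t) - h p`, zero only at `t = 0`, plus the tangent defect at
  -- `t`, zero only at `t = Δ`; since `Δ > 0` they never vanish together. For `p ≤ t` it is `h
  -- (bconv p t) - h t ≥ 0` plus the tangent defect at `p`, positive because `Δ < p`.
  rcases le_total p t with hpt | htp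
  · rw [min_eq_right hpt]
    have h1 := h_lt_tangent hΔ (by linarith) hp.le (by linarith) hΔp.ne'
    have h2 : h t ≤ h (bconv p t) := by
      refine h_le_h ht ?_ hb1
      have : 0 ≤ p * (1 - 2 * t) := mul_nonneg hp.le (by linarith)
      unfold bconv; linarith
    linarith
  · rw [min_eq_left htp]
    rcases ht.eq_or_lt with rfl | ht0
    · have h1 := h_lt_tangent hΔ (by linarith) le_rfl zero_le_one hΔ.ne
      simp only [bconv, sub_zero, mul_one, mul_zero, add_zero]
      linarith
    · have h2 : h p < h (bconv p t) := by
        refine h_lt_h hp.le ?_ hb1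
        have : 0 < t * (1 - 2 * p) := mul_pos ht0 (by linarith)
        unfold bconv; linarith
      rcases eq_or_ne t Δ with rfl | hne
      · simp only [sub_self, mul_zero]; linarith
      · have h1 := h_lt_tangent hΔ (by linarith) ht ht' hne
        linarith

/-- The Wyner–Ziv rate is an infimum, so pointwise positivity of the gap would not give a strict
inequality; its minimum on the compact interval does. -/
lemma exists_wz_gap {p Δ : ℝ} (hp' : p < 1 / 2) (hΔ : 0 < Δ) (hΔp : Δ < p) :
    ∃ ε > 0, ∀ t ∈ Set.Icc (0 : ℝ) 1, ε ≤
      h (bconv p t) - h t - (h p - h Δ) + hSlope Δ * (min (min t (1 - t)) p - Δ) := by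
  have hcont : Continuous fun t : ℝ =>
      h (bconv p t) - h t - (h p - h Δ) + hSlope Δ * (min (min t (1 - t)) p - Δ) := by
    have h1 : Continuous fun t : ℝ => h (bconv p t) :=
      continuous_h.comp (by unfold bconv; fun_prop)
    have h2 := continuous_h
    fun_prop
  obtain ⟨t₀, ht₀, hmin⟩ := isCompact_Icc.exists_isMinOn (Set.nonempty_Icc.2 zero_le_one)
    hcont.continuousOn
  exact ⟨_, wz_gap_pos hp' hΔ hΔp ht₀.1 ht₀.2, fun t ht => hmin ht⟩

/-- The expected distortion on the event `U = u` is at least the one of the best reproduction. -/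
lemma le_sum_hamming {p m t : ℝ} (hp' : p < 1 / 2) (hm : 0 ≤ m) (f : Fin 2 → Fin 2) :
    m * min (min t (1 - t)) p ≤
      ∑ x, ∑ y, dsbs p (x, y) * (2 * m * bern t x) * hamming x (f y) := by
  have h1 : min (min t (1 - t)) p ≤ t := (min_le_left _ _).trans (min_le_left _ _)
  have h2 : min (min t (1 - t)) p ≤ 1 - t := (min_le_left _ _).trans (min_le_right _ _)
  have h3 : min (min t (1 - t)) p ≤ p := min_le_right _ _
  have h4 : min (min t (1 - t)) p ≤ 1 - p := h3.trans (by linarith)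
  have hcase : ∀ s, min (min t (1 - t)) p ≤ s →
      ∑ x, ∑ y, dsbs p (x, y) * (2 * m * bern t x) * hamming x (f y) = m * s →
      m * min (min t (1 - t)) p ≤
        ∑ x, ∑ y, dsbs p (x, y) * (2 * m * bern t x) * hamming x (f y) :=
    fun s hs he => by rw [he]; exact mul_le_mul_of_nonneg_left hs hm
  have hf : ∀ y, f y = 0 ∨ f y = 1 := fun y => by
    generalize f y = b
    fin_cases b <;> simp
  -- The four decision rules, constant 0, `y`, its complement and constant 1, have error
  -- probabilities `t`, `p`, `1 - p` and `1 - t`.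
  rcases hf 0 with h0 | h0 <;> rcases hf 1 with h1' | h1'
  · refine hcase t h1 ?_
    simp [Fin.sum_univ_two, dsbs, bern, hamming, h0, h1']; ring
  · refine hcase p h3 ?_
    simp [Fin.sum_univ_two, dsbs, bern, hamming, h0, h1']; ring
  · refine hcase (1 - p) h4 ?_
    simp [Fin.sum_univ_two, dsbs, bern, hamming, h0, h1']; ring
  · refine hcase (1 - t) h2 ?_
    simp [Fin.sum_univ_two, dsbs, bern, hamming, h0, h1']; ring

/-- The rate of a test channel is `H(Y,U) - H(X,U)`, since the two marginals are uniform. -/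
lemma mutualInfo_sub_mutualInfo_dsbs (p : ℝ) {k : ℕ} {W : Fin 2 → Fin k → ℝ}
    (hW : ∀ x, ∑ u, W x u = 1) :
    mutualInfo (fun xu : Fin 2 × Fin k => ∑ y, dsbs p (xu.1, y) * W xu.1 xu.2) -
      mutualInfo (fun yu : Fin 2 × Fin k => ∑ x, dsbs p (x, yu.1) * W x yu.2) =
    ∑ u, (entropyTwo ((1 - p) / 2 * W 0 u + p / 2 * W 1 u) (p / 2 * W 0 u + (1 - p) / 2 * W 1 u) -
      entropyTwo (1 / 2 * W 0 u) (1 / 2 * W 1 u)) := by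
  have hX : (fun x => ∑ u, ∑ y, dsbs p (x, y) * W x u) = fun _ => (1 / 2 : ℝ) := by
    funext x
    simp only [← Finset.sum_mul, ← Finset.mul_sum, hW]
    fin_cases x <;> simp [dsbs, Fin.sum_univ_two] <;> ring
  have hY : (fun y => ∑ u, ∑ x, dsbs p (x, y) * W x u) = fun _ => (1 / 2 : ℝ) := by
    funext y
    rw [Finset.sum_comm]
    simp only [← Finset.mul_sum, hW]
    fin_cases y <;> simp [dsbs, Fin.sum_univ_two] <;> ring
  have hU : (fun u => ∑ x, ∑ y, dsbs p (x, y) * W x u) =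
      fun u => ∑ y, ∑ x, dsbs p (x, y) * W x u := by
    funext u
    exact Finset.sum_comm
  have h0 : ∀ u, ∑ y, dsbs p (0, y) * W 0 u = 1 / 2 * W 0 u := by
    intro u; simp [dsbs, Fin.sum_univ_two]; ring
  have h1 : ∀ u, ∑ y, dsbs p (1, y) * W 1 u = 1 / 2 * W 1 u := by
    intro u; simp [dsbs, Fin.sum_univ_two]; ring
  have h2 : ∀ u, ∑ x, dsbs p (x, 0) * W x u = (1 - p) / 2 * W 0 u + p / 2 * W 1 u := by
    intro u; simp [dsbs, Fin.sum_univ_two]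
  have h3 : ∀ u, ∑ x, dsbs p (x, 1) * W x u = p / 2 * W 0 u + (1 - p) / 2 * W 1 u := by
    intro u; simp [dsbs, Fin.sum_univ_two]
  simp only [mutualInfo]
  rw [hX, hY, hU]
  simp only [entropy, Fintype.sum_prod_type]
  rw [Fin.sum_univ_two (fun x => ∑ u, (∑ y, dsbs p (x, y) * W x u) * _),
    Fin.sum_univ_two (fun y => ∑ u, (∑ x, dsbs p (x, y) * W x u) * _)]
  simp only [h0, h1, h2, h3, entropyTwo, Finset.sum_sub_distrib, Finset.sum_neg_distrib]
  ring

/-- The Wyner–Ziv rates are bounded away from `h p - h Δ`. -/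
lemma exists_lt_wzRates {p Δ : ℝ} (hp' : p < 1 / 2) (hΔ : 0 < Δ) (hΔp : Δ < p) :
    ∃ ε > 0, ∀ r ∈ wzRates (dsbs p) hamming Δ, h p - h Δ + ε ≤ r := by
  obtain ⟨ε, hε, hgap⟩ := exists_wz_gap hp' hΔ hΔp
  have hl := hSlope_pos hΔ (hΔp.trans hp')
  refine ⟨ε, hε, ?_⟩
  rintro r ⟨k, -, W, hW, ⟨φ, hφ⟩, rfl⟩
  rw [mutualInfo_sub_mutualInfo_dsbs p fun x => (hW x).2]
  set m : Fin k → ℝ := fun u => (W 0 u + W 1 u) / 2 with hm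
  have hm1 : ∑ u, m u = 1 := by
    simp only [hm, ← Finset.sum_div, Finset.sum_add_distrib, (hW 0).2, (hW 1).2]
    norm_num
  -- Lagrangian form: charging distortion at the price `hSlope Δ` makes the bound additive over the
  -- letters `u`, so the constraint enters only after summation.
  have key : ∀ u, m u * (h p - h Δ + hSlope Δ * Δ + ε) -
      hSlope Δ * ∑ x, ∑ y, dsbs p (x, y) * W x u * hamming x (φ u y) ≤
      entropyTwo ((1 - p) / 2 * W 0 u + p / 2 * W 1 u) (p / 2 * W 0 u + (1 - p) / 2 * W 1 u) -
      entropyTwo (1 / 2 * W 0 u) (1 / 2 * W 1 u) := by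
    intro u
    have hW0 : 0 ≤ W 0 u := (hW 0).1 u
    have hW1 : 0 ≤ W 1 u := (hW 1).1 u
    have hmu : 0 ≤ m u := by simp only [hm]; linarith
    rcases hmu.eq_or_lt with h0 | hpos
    · have hW0' : W 0 u = 0 := by simp only [hm] at h0; linarith
      have hW1' : W 1 u = 0 := by simp only [hm] at h0; linarith
      rw [← h0]
      simp [Fin.sum_univ_two, hW0', hW1']
    -- As `X` is uniform, `m u = P(U = u)` and `t = P(X = 1 | U = u)`.
    · set t := W 1 u / (2 * m u) with ht
      have h1 : W 1 u = 2 * m u * t := by rw [ht]; field_simp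
      have h0 : W 0 u = 2 * m u * (1 - t) := by
        have : W 0 u + W 1 u = 2 * m u := by simp only [hm]; ring
        linarith
      have ht0 : 0 ≤ t := div_nonneg hW1 (by linarith)
      have ht1 : t ≤ 1 := by
        by_contra! hlt
        have := mul_pos hpos (sub_pos.2 hlt)
        linarith
      have hWx : ∀ x, W x u = 2 * m u * bern t x := by
        intro x; fin_cases x <;> simp [bern, h0, h1]
      have hd := le_sum_hamming (t := t) hp' hmu (φ u)
      simp only [← hWx] at hd
      have hg := mul_le_mul_of_nonneg_left (hgap t ⟨ht0, ht1⟩) hmu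
      have hd' := mul_le_mul_of_nonneg_left hd hl.le
      have e1 : entropyTwo (1 / 2 * W 0 u) (1 / 2 * W 1 u) = m u * h t - m u * Real.logb 2 (m u) := by
        rw [← entropyTwo_mul hpos.ne', h0, h1]; congr 1 <;> ring
      have e2 : entropyTwo ((1 - p) / 2 * W 0 u + p / 2 * W 1 u)
          (p / 2 * W 0 u + (1 - p) / 2 * W 1 u) =
          m u * h (bconv p t) - m u * Real.logb 2 (m u) := by
        rw [← entropyTwo_mul hpos.ne', h0, h1, bconv]; congr 1 <;> ring
      rw [e1, e2]
      linarith
  refine le_trans ?_ (Finset.sum_le_sum fun u _ => key u)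
  rw [Finset.sum_sub_distrib, ← Finset.sum_mul, hm1, ← Finset.mul_sum]
  have hswap : ∑ u, ∑ x, ∑ y, dsbs p (x, y) * W x u * hamming x (φ u y) =
      ∑ x, ∑ y, ∑ u, dsbs p (x, y) * W x u * hamming x (φ u y) := by
    rw [Finset.sum_comm]
    exact Finset.sum_congr rfl fun x _ => Finset.sum_comm
  rw [hswap]
  have := mul_le_mul_of_nonneg_left hφ hl.le
  linarith

lemma wzRates_nonempty (p : ℝ) {Δ : ℝ} (hΔ : 0 ≤ Δ) : (wzRates (dsbs p) hamming Δ).Nonempty := by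
  -- The choice `U = X` reproduces `X` without distortion.
  refine ⟨_, 2, by simp, fun x => Pi.single x 1, fun x => single_mem_stdSimplex ℝ x,
    ⟨fun u _ => u, ?_⟩, rfl⟩
  simpa [Fin.sum_univ_two, hamming] using hΔ

lemma lt_wzRate {p Δ : ℝ} (hp' : p < 1 / 2) (hΔ : 0 < Δ) (hΔp : Δ < p) :
    h p - h Δ < wzRate (dsbs p) hamming Δ := by
  obtain ⟨ε, hε, hle⟩ := exists_lt_wzRates hp' hΔ hΔp
  have := le_csInf (wzRates_nonempty p hΔ.le) hle
  exact (lt_add_of_pos_right _ hε).trans_le this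

end ComplementaryDelivery

theorem mainTheorem5 :
    (∃ P ∈ stdSimplex ℝ (Fin 2 × Fin 2), ∃ d₁ d₂ : Fin 2 → Fin 2 → ℝ, ∃ Δ₁ Δ₂ : ℝ,
      (∀ a b, 0 ≤ d₁ a b) ∧ (∀ a b, 0 ≤ d₂ a b) ∧
      (ComplementaryDelivery.achievableRates P d₁ d₂ Δ₁ Δ₂).Nonempty ∧
      (ComplementaryDelivery.wzRates P d₁ Δ₁).Nonempty ∧
      (ComplementaryDelivery.wzRates (ComplementaryDelivery.swapped P) d₂ Δ₂).Nonempty ∧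
      ComplementaryDelivery.optimalRate P d₁ d₂ Δ₁ Δ₂ <
        max (ComplementaryDelivery.wzRate P d₁ Δ₁)
          (ComplementaryDelivery.wzRate (ComplementaryDelivery.swapped P) d₂ Δ₂)) ∧
    (∀ p Δ : ℝ, 0 < p → p < 1 / 2 → 0 ≤ Δ → Δ < p →
      ComplementaryDelivery.dsbs p ∈ stdSimplex ℝ (Fin 2 × Fin 2) ∧
      ComplementaryDelivery.optimalRate (ComplementaryDelivery.dsbs p)
          ComplementaryDelivery.hamming ComplementaryDelivery.hamming Δ Δ =
        ComplementaryDelivery.h p - ComplementaryDelivery.h Δ ∧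
      (0 < Δ →
        ComplementaryDelivery.h p - ComplementaryDelivery.h Δ <
          ComplementaryDelivery.wzRate (ComplementaryDelivery.dsbs p)
            ComplementaryDelivery.hamming Δ ∧
        ComplementaryDelivery.h p - ComplementaryDelivery.h Δ <
          ComplementaryDelivery.wzRate
            (ComplementaryDelivery.swapped (ComplementaryDelivery.dsbs p))
            ComplementaryDelivery.hamming Δ)) := by
  open ComplementaryDelivery in
  refine ⟨⟨dsbs (1 / 4), dsbs_mem_stdSimplex (by norm_num) (by norm_num), hamming, hamming,
    1 / 8, 1 / 8, ?_, ?_, achievableRates_nonempty (by norm_num) (by norm_num) (by norm_num),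
    wzRates_nonempty _ (by norm_num), ?_, ?_⟩, fun p Δ hp hp' hΔ hΔp =>
    ⟨dsbs_mem_stdSimplex hp.le (by linarith), optimalRate_dsbs hp' hΔ hΔp, fun hΔ0 =>
      ⟨lt_wzRate hp' hΔ0 hΔp, ?_⟩⟩⟩
  · intro a b; unfold hamming; split_ifs <;> norm_num
  · intro a b; unfold hamming; split_ifs <;> norm_num
  · rw [swapped_dsbs]
    exact wzRates_nonempty _ (by norm_num)
  · rw [optimalRate_dsbs (by norm_num) (by norm_num) (by norm_num)]
    exact lt_max_of_lt_left (lt_wzRate (by norm_num) (by norm_num) (by norm_num))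
  · rw [swapped_dsbs]
    exact lt_wzRate hp' hΔ0 hΔp
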